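/- **Setting.** Let $X$ be a set of instances, $D = X\times\{-1,1\}$ the set of labelled examples, and $(D,\Sigma,P)$ a probability space on which the label $(x,y)\mapsto y$ is measurable. Let $\mathcal H$ be a set of hypotheses $X\to\{-1,1\}$ and $(x^{(1)},y^{(1)}),\dots,(x^{(m)},y^{(m)})$ a training sample. Each $h\in\mathcal H$ induces a row $\eta\in\{0,1\}^m$, where $\eta(i)=1$ if and only if $h(x^{(i)})\ne y^{(i)}$. Let $M$ be the (finite) set of these rows, and for a row $\eta$ let $H(\eta)$ be the set of $h\in\mathcal H$ that induce $\eta$. For $w$ in the simplex $\Delta_m=\{w\in\mathbb R^m : w(i)\ge 0,\ \sum_i w(i)=1\}$ put $\epsilon(w)=\min_{\eta\in M}\eta\cdot w$ and $\alpha(w)=\frac12\log\frac{1-\epsilon(w)}{\epsilon(w)}$, and let $\eta^w$ be the element of $\operatorname{argmin}_{\eta\in M}\eta\cdot w$ chosen by a fixed tie-breaking function. Optimal AdaBoost starts at some $w_1\in\Delta_m$ and updates $$w_{t+1}(i)=\tfrac12 w_t(i)\Big(\frac1{\eta_t\cdot w_t}\Big)^{\eta_t(i)}\Big(\frac1{1-\eta_t\cdot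 w_t}\Big)^{1-\eta_t(i)},\qquad \eta_t=\eta^{w_t}.$$ Assume $0<\epsilon(w_t)<1$ for all $t$, so that the run is defined. In round $t$ the weak learner returns some $h_t\in H(\eta_t)$ (for instance a fixed representative of the class $H(\eta_t)$). Let $$F_T(x)=\sum_{t=1}^T\alpha(w_t)h_t(x),\qquad H_T(x)=\operatorname{sign}(F_T(x)),\qquad \operatorname{sign}(0)=0,$$ and assume that each $H_T$ is measurable on $(D,\Sigma,P)$. The generalization error of $H$ is $\mathrm{err}_D(H)=\int_D\frac{1-yH(x)}2\,dP$. **Theorem.** Let $E$ be the set of $(x,y)\in D$ for which $\lim_{T\to\infty}\frac1TF_T(x)$ exists and is not $0$, and suppose that $E$ is measurable. Then $H^*(x)=\lim_{T\to\infty}H_T(x)$ exists for every $(x,y)\in E$, the function $\frac{1-yH^*(x)}2$ is integrable on $E$, and 1. $\displaystyle\limsup_{T\to\infty}\mathrm{err}_D(H_T)\le\int_{E}\frac{1-yH^*(x)}2\,dP+P(D\setminus E)$; 2. $\displaystyle\liminf_{T\to\infty}\mathrm{err}_D(H_T)\ge\int_{E}\frac{1-yH^*(x)}2\,dP-P(D\setminus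 E)$. Moreover, if $\lim_{T\to\infty}\mathrm{err}_D(H_T)$ exists, then $$\Big|\lim_{T\to\infty}\mathrm{err}_D(H_T)-\int_{E}\frac{1-yH^*(x)}2\,dP\Big|\le P(D\setminus E).$$ -/

import Mathlib

open Filter Topology MeasureTheory

namespace OptAdaBoost

noncomputable section

/-- Labels are the two signs `-1` and `1`. -/
abbrev Label : Type := ℤˣ

/-- The label as a real number. -/
def Label.toReal (y : Label) : ℝ := ((y : ℤ) : ℝ)

/-- A 0-1 row vector over the `m` training examples: entry `1` marks a misclassified example. -/
abbrev Row (m : ℕ) : Type := Fin m → Fin 2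

variable {X : Type*} {m : ℕ}

/-- The row of mistakes made by the hypothesis `h` on the labelled training sample `S`. -/
def mistakes (S : Fin m → X × Label) (h : X → Label) : Row m :=
  fun i => if h (S i).1 = (S i).2 then 0 else 1

/-- The error matrix, as the set of its rows. -/
def errorMatrix (𝓗 : Set (X → Label)) (S : Fin m → X × Label) : Set (Row m) :=
  mistakes S '' 𝓗

/-- The hypotheses of `𝓗` that induce the row `η` on the sample. -/
def hypClass (𝓗 : Set (X → Label)) (S : Fin m → X × Label) (η : Row m) : Set (X → Label) :=
  {h | h ∈ 𝓗 ∧ mistakes S h = η}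

/-- The weighted error `η · w`. -/
def rowErr (η : Row m) (w : Fin m → ℝ) : ℝ := ∑ i, ((η i : ℕ) : ℝ) * w i

/-- The rows of `M` of least weighted error. -/
def argminRows (M : Set (Row m)) (w : Fin m → ℝ) : Set (Row m) :=
  {η | η ∈ M ∧ ∀ η' ∈ M, rowErr η w ≤ rowErr η' w}

/-- `sel` is a tie-breaking rule on `M`: it picks an element of every nonempty set of rows. -/
def IsTieBreaking (M : Set (Row m)) (sel : Set (Row m) → Row m) : Prop :=
  ∀ A : Set (Row m), A ⊆ M → A.Nonempty → sel A ∈ A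

/-- The best row for the weight `w`. -/
def bestRow (M : Set (Row m)) (sel : Set (Row m) → Row m) (w : Fin m → ℝ) : Row m :=
  sel (argminRows M w)

/-- The update of the weight `w` under the assumption that `η` is the selected row. -/
def rowUpdate (η : Row m) (w : Fin m → ℝ) : Fin m → ℝ := fun i =>
  1 / 2 * w i * (1 / rowErr η w) ^ (η i : ℕ) * (1 / (1 - rowErr η w)) ^ (1 - (η i : ℕ))

/-- The weight update of Optimal AdaBoost. -/
def update (M : Set (Row m)) (sel : Set (Row m) → Row m) (w : Fin m → ℝ) : Fin m → ℝ :=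
  rowUpdate (bestRow M sel w) w

/-- The least weighted error over the rows of `M` (a finite set). -/
def minErr (M : Set (Row m)) (w : Fin m → ℝ) : ℝ := sInf ((fun η => rowErr η w) '' M)

/-- The coefficient that AdaBoost gives to the hypothesis selected at the weight `w`. -/
def coeff (M : Set (Row m)) (w : Fin m → ℝ) : ℝ :=
  1 / 2 * Real.log ((1 - minErr M w) / minErr M w)

/-- The weights along the run. Rounds are numbered from `0`: `weights M sel w₁ t` is the weight
vector obtained from the initial one after `t` updates. -/
def weights (M : Set (Row m)) (sel : Set (Row m) → Row m) (w₁ : Fin m → ℝ) (t : ℕ) :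
    Fin m → ℝ :=
  (update M sel)^[t] w₁

/-- The weighted vote `F_T` of the first `T` selected hypotheses `h 0, …, h (T - 1)`. -/
def vote (M : Set (Row m)) (sel : Set (Row m) → Row m) (w₁ : Fin m → ℝ) (h : ℕ → X → Label)
    (T : ℕ) (x : X) : ℝ :=
  ∑ t ∈ Finset.range T, coeff M (weights M sel w₁ t) * (h t x).toReal

/-- The AdaBoost classifier `H_T = sign F_T` (with `sign 0 = 0`). -/
def classifier (M : Set (Row m)) (sel : Set (Row m) → Row m) (w₁ : Fin m → ℝ)
    (h : ℕ → X → Label) (T : ℕ) (x : X) : ℝ :=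
  Real.sign (vote M sel w₁ h T x)

/-- The limit classifier `H*(x) = lim H_T(x)`, meaningful where the limit exists. -/
def limitClassifier (M : Set (Row m)) (sel : Set (Row m) → Row m) (w₁ : Fin m → ℝ)
    (h : ℕ → X → Label) (x : X) : ℝ :=
  limUnder atTop (fun T : ℕ => classifier M sel w₁ h T x)

/-- The set of labelled examples for which `lim F_T(x) / T` exists and is not `0`. -/
def nonzeroLimitSet (M : Set (Row m)) (sel : Set (Row m) → Row m) (w₁ : Fin m → ℝ)
    (h : ℕ → X → Label) : Set (X × Label) :=
  {z | ∃ l : ℝ, l ≠ 0 ∧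
    Tendsto (fun T : ℕ => 1 / (T : ℝ) * vote M sel w₁ h T z.1) atTop (𝓝 l)}

/-- The loss `(1 - y H(x)) / 2` of a classifier at the labelled example `(x, y)`. -/
def loss (H : X → ℝ) (z : X × Label) : ℝ := (1 - z.2.toReal * H z.1) / 2

/-- The generalization error `E[(1 - y H(x)) / 2]`. -/
def genErr [MeasurableSpace (X × Label)] (P : Measure (X × Label)) (H : X → ℝ) : ℝ :=
  ∫ z, loss H z ∂P

end

end OptAdaBoost

namespace OptAdaBoost

/-! If `F_T(x) / T` has a nonzero limit, `F_T(x)` eventually has the sign of that limit, so the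
classifiers are eventually constant at each point of `E`. Losses lie in `[0, 1]`, so dominated
convergence gives the limit of their integrals over `E`. Off `E` the loss may oscillate, but it
contributes between `0` and `P Eᶜ`. The error is thus squeezed between the integral over `E` and
that integral plus `P Eᶜ` (`integral_bounds_of_tendsto_on`). -/

lemma Label.toReal_eq_neg_one_or_one (y : Label) : y.toReal = -1 ∨ y.toReal = 1 := by
  rcases Int.units_eq_one_or y with rfl | rfl <;> simp [Label.toReal]

lemma loss_sign_mem_Icc {X : Type*} (F : X → ℝ) (z : X × Label) :
    loss (fun x => Real.sign (F x)) z ∈ Set.Icc (0 : ℝ) 1 := by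
  unfold loss
  rcases Label.toReal_eq_neg_one_or_one z.2 with hy | hy <;>
    rcases Real.sign_apply_eq (F z.1) with hs | hs | hs <;> simp only [hy, hs] <;> norm_num

/-- If `u T / T` has a nonzero limit, then the sign of `u T` converges. -/
lemma exists_tendsto_sign_of_tendsto_average {u : ℕ → ℝ} {l : ℝ} (hl : l ≠ 0)
    (hu : Tendsto (fun T : ℕ => 1 / (T : ℝ) * u T) atTop (𝓝 l)) :
    ∃ s, Tendsto (fun T => Real.sign (u T)) atTop (𝓝 s) := by
  rcases lt_or_gt_of_ne hl with hneg | hpos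
  · refine ⟨-1, tendsto_const_nhds.congr' ?_⟩
    filter_upwards [hu.eventually_lt_const hneg] with T hT
    -- `1 / T ≥ 0` suffices, so `T = 0`, where Lean has `1 / 0 = 0`, needs no separate case.
    exact (Real.sign_of_neg (neg_of_mul_neg_right hT (by positivity))).symm
  · refine ⟨1, tendsto_const_nhds.congr' ?_⟩
    filter_upwards [hu.eventually_const_lt hpos] with T hT
    exact (Real.sign_of_pos (pos_of_mul_pos_right hT (by positivity))).symm

/-- Measurable losses with values in `[0, 1]` that converge on `E`: the integral over `E`
converges, and the integral over the whole space differs from it by at most `P Eᶜ`. -/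
lemma integral_bounds_of_tendsto_on {Ω : Type*} [MeasurableSpace Ω] (P : Measure Ω)
    [IsProbabilityMeasure P] {E : Set Ω} (hE : MeasurableSet E) {f : ℕ → Ω → ℝ} {g : Ω → ℝ}
    (hf : ∀ n, Measurable (f n)) (hf01 : ∀ n z, f n z ∈ Set.Icc (0 : ℝ) 1)
    (hlim : ∀ z ∈ E, Tendsto (fun n => f n z) atTop (𝓝 (g z))) :
    IntegrableOn g E P ∧
      Tendsto (fun n => ∫ z in E, f n z ∂P) atTop (𝓝 (∫ z in E, g z ∂P)) ∧
      ∀ n, (∫ z in E, f n z ∂P) ≤ (∫ z, f n z ∂P) ∧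
        (∫ z, f n z ∂P) ≤ (∫ z in E, f n z ∂P) + P.real Eᶜ := by
  have hlim' : ∀ᵐ z ∂P.restrict E, Tendsto (fun n => f n z) atTop (𝓝 (g z)) :=
    (ae_restrict_iff' hE).2 (Eventually.of_forall hlim)
  have hnorm : ∀ n z, ‖f n z‖ ≤ 1 := fun n z => by
    rw [Real.norm_of_nonneg (hf01 n z).1]; exact (hf01 n z).2
  have hint : ∀ n, Integrable (f n) P := fun n =>
    Integrable.of_bound (hf n).aestronglyMeasurable 1 (Eventually.of_forall (hnorm n))
  refine ⟨?_, ?_, fun n => ?_⟩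
  -- `g` inherits a.e. measurability on `E`, and the bound `1`, from the `f n`.
  · refine Integrable.of_bound (C := 1) (aestronglyMeasurable_of_tendsto_ae atTop
      (fun n => (hf n).aestronglyMeasurable) hlim') ?_
    filter_upwards [hlim'] with z hz
    exact le_of_tendsto hz.norm (Eventually.of_forall fun n => hnorm n z)
  · exact tendsto_integral_of_dominated_convergence (fun _ => 1)
      (fun n => (hf n).aestronglyMeasurable) (integrable_const 1)
      (fun n => Eventually.of_forall (hnorm n)) hlim'
  · have hsplit := integral_add_compl hE (hint n)
    have h0 : 0 ≤ ∫ z in Eᶜ, f n z ∂P := integral_nonneg fun z => (hf01 n z).1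
    have h1 : ∫ z in Eᶜ, f n z ∂P ≤ ∫ _ in Eᶜ, (1 : ℝ) ∂P :=
      integral_mono (hint n).integrableOn (integrable_const 1) fun z => (hf01 n z).2
    rw [setIntegral_const, smul_eq_mul, mul_one] at h1
    constructor <;> linarith

end OptAdaBoost

theorem mainTheorem7 {X : Type*} [MeasurableSpace (X × OptAdaBoost.Label)]
    (P : Measure (X × OptAdaBoost.Label)) [IsProbabilityMeasure P]
    (hlabel : Measurable fun z : X × OptAdaBoost.Label => z.2.toReal)
    {m : ℕ} (S : Fin m → X × OptAdaBoost.Label)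
    (𝓗 : Set (X → OptAdaBoost.Label))
    (M : Set (OptAdaBoost.Row m)) (hM : M = OptAdaBoost.errorMatrix 𝓗 S)
    (sel : Set (OptAdaBoost.Row m) → OptAdaBoost.Row m)
    (hsel : OptAdaBoost.IsTieBreaking M sel)
    (w₁ : Fin m → ℝ) (hw₁ : w₁ ∈ stdSimplex ℝ (Fin m))
    (hdef : ∀ t : ℕ, 0 < OptAdaBoost.minErr M (OptAdaBoost.weights M sel w₁ t) ∧
      OptAdaBoost.minErr M (OptAdaBoost.weights M sel w₁ t) < 1)
    (h : ℕ → X → OptAdaBoost.Label)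
    (hh : ∀ t : ℕ, h t ∈ OptAdaBoost.hypClass 𝓗 S
      (OptAdaBoost.bestRow M sel (OptAdaBoost.weights M sel w₁ t)))
    (hmeas : ∀ T : ℕ, Measurable fun z : X × OptAdaBoost.Label =>
      OptAdaBoost.classifier M sel w₁ h T z.1)
    (E : Set (X × OptAdaBoost.Label)) (hE : E = OptAdaBoost.nonzeroLimitSet M sel w₁ h)
    (hEmeas : MeasurableSet E) :
    (∀ z ∈ E, Tendsto (fun T : ℕ => OptAdaBoost.classifier M sel w₁ h T z.1) atTop
      (𝓝 (OptAdaBoost.limitClassifier M sel w₁ h z.1))) ∧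
    IntegrableOn (OptAdaBoost.loss (OptAdaBoost.limitClassifier M sel w₁ h)) E P ∧
    limsup (fun T : ℕ => OptAdaBoost.genErr P (OptAdaBoost.classifier M sel w₁ h T)) atTop ≤
      (∫ z in E, OptAdaBoost.loss (OptAdaBoost.limitClassifier M sel w₁ h) z ∂P) + P.real Eᶜ ∧
    (∫ z in E, OptAdaBoost.loss (OptAdaBoost.limitClassifier M sel w₁ h) z ∂P) - P.real Eᶜ ≤
      liminf (fun T : ℕ => OptAdaBoost.genErr P (OptAdaBoost.classifier M sel w₁ h T)) atTop ∧
    ∀ L : ℝ,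
      Tendsto (fun T : ℕ => OptAdaBoost.genErr P (OptAdaBoost.classifier M sel w₁ h T)) atTop
        (𝓝 L) →
      |L - ∫ z in E, OptAdaBoost.loss (OptAdaBoost.limitClassifier M sel w₁ h) z ∂P| ≤
        P.real Eᶜ := by
  have hconv : ∀ z ∈ E, Tendsto (fun T : ℕ => OptAdaBoost.classifier M sel w₁ h T z.1) atTop
      (𝓝 (OptAdaBoost.limitClassifier M sel w₁ h z.1)) := by
    intro z hz
    rw [hE] at hz
    obtain ⟨l, hl, hlim⟩ := hz
    exact tendsto_nhds_limUnder (OptAdaBoost.exists_tendsto_sign_of_tendsto_average hl hlim)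
  obtain ⟨hint, htend, hbd⟩ := OptAdaBoost.integral_bounds_of_tendsto_on P hEmeas
    (f := fun T => OptAdaBoost.loss (OptAdaBoost.classifier M sel w₁ h T))
    (g := OptAdaBoost.loss (OptAdaBoost.limitClassifier M sel w₁ h))
    (fun T => ((hlabel.mul (hmeas T)).const_sub 1).div_const 2)
    (fun T z => OptAdaBoost.loss_sign_mem_Icc (OptAdaBoost.vote M sel w₁ h T) z)
    (fun z hz => (((hconv z hz).const_mul _).const_sub 1).div_const 2)
  have hlo : ∀ T, (∫ z in E, OptAdaBoost.loss (OptAdaBoost.classifier M sel w₁ h T) z ∂P) ≤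
      OptAdaBoost.genErr P (OptAdaBoost.classifier M sel w₁ h T) := fun T => (hbd T).1
  have hup : ∀ T, OptAdaBoost.genErr P (OptAdaBoost.classifier M sel w₁ h T) ≤
      (∫ z in E, OptAdaBoost.loss (OptAdaBoost.classifier M sel w₁ h T) z ∂P) + P.real Eᶜ :=
    fun T => (hbd T).2
  have htend' := htend.add_const (P.real Eᶜ)
  have hp : 0 ≤ P.real Eᶜ := measureReal_nonneg
  refine ⟨hconv, hint, ?_, ?_, fun L hL => ?_⟩
  -- Monotonicity of `limsup` in `ℝ` needs boundedness; the convergent integrals over `E` supply it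
  -- on both sides.
  · rw [← htend'.limsup_eq]
    exact limsup_le_limsup (Eventually.of_forall hup)
      (htend.isBoundedUnder_ge.mono_ge (Eventually.of_forall hlo)).isCoboundedUnder_le
      htend'.isBoundedUnder_le
  -- Since the loss is nonnegative off `E`, the lower bound holds even without subtracting `P Eᶜ`.
  · refine (sub_le_self _ hp).trans ?_
    rw [← htend.liminf_eq]
    exact liminf_le_liminf (Eventually.of_forall hlo) htend.isBoundedUnder_ge
      (htend'.isBoundedUnder_le.mono_le (Eventually.of_forall hup)).isCoboundedUnder_ge
  · have h1 := le_of_tendsto_of_tendsto' htend hL hlo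
    have h2 := le_of_tendsto_of_tendsto' hL htend' hup
    rw [abs_le]
    constructor <;> linarith
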